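/- All spaces are metric. A metric space $X$ is *uniformly locally connected* (ULC) if for every $\varepsilon>0$ there is $\delta>0$ such that any two points of $X$ at distance $<\delta$ lie in a connected subset of $X$ of diameter $<\varepsilon$. It is *straight* if, whenever $X$ is the union of finitely many closed sets, a continuous function $f\colon X\to\mathbb R$ is uniformly continuous if and only if its restriction to each of these closed sets is uniformly continuous. It is *precompact* if it is totally bounded. **Theorem B.** For each $n\in\mathbb N$ let $(X_n,d_n)$ be a nonempty ULC metric space, and let $X=\prod_{n\in\mathbb N}X_n$ be equipped with the metric $$d(x,y)=\sum_{n\in\mathbb N}\frac1{2^n}\min\{1,d_n(x_n,y_n)\}.$$ (This is $\sum_n 2^{-n}d_n(x_n,y_n)$ when all $d_n$ are bounded by $1$.) (a) $X$ is ULC if and only if all but finitely many of the spaces $X_n$ are connected. (b) The following are equivalent: - (b$_1$) $X$ is straight; - (b$_2$) either $X$ is ULC or every $X_n$ is precompact. -/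

import Mathlib

open Set

universe u

/-- A metric space is uniformly locally connected (ULC) if for every `ε > 0` there is `δ > 0` such
that any two points at distance `< δ` lie in a connected set of diameter `< ε`.  The diameter is
taken in `[0, ∞]`, so that an unbounded set has infinite diameter. -/
def IsULC (X : Type u) [MetricSpace X] : Prop :=
  ∀ ε : ℝ, 0 < ε → ∃ δ : ℝ, 0 < δ ∧ ∀ x y : X, dist x y < δ →
    ∃ C : Set X, IsConnected C ∧ x ∈ C ∧ y ∈ C ∧ Metric.ediam C < ENNReal.ofReal ε

/-- A metric space `X` is straight if, whenever `X` is the union of finitely many closed sets,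
a continuous function `f : X → ℝ` is uniformly continuous if and only if its restriction to each of
these closed sets is uniformly continuous. -/
def IsStraight (X : Type u) [MetricSpace X] : Prop :=
  ∀ F : Set (Set X), F.Finite → (∀ C ∈ F, IsClosed C) → ⋃₀ F = univ →
    ∀ f : X → ℝ, Continuous f → (UniformContinuous f ↔ ∀ C ∈ F, UniformContinuousOn f C)

/-- A metric space is precompact if it is totally bounded, i.e. for each `ε > 0` it is covered by
finitely many balls of radius `ε`. -/
def IsPrecompact (X : Type u) [MetricSpace X] : Prop :=
  TotallyBounded (univ : Set X)

/-- The product of a sequence of metric spaces, with the metric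
`d (x, y) = ∑ n, 2⁻ⁿ * min 1 (dₙ (xₙ, yₙ))`. -/
def SeqProd (X : ℕ → Type u) : Type u := ∀ n, X n

namespace SeqProd

variable {X : ℕ → Type u} [∀ n, MetricSpace (X n)]

noncomputable instance instDist : Dist (SeqProd X) where
  dist x y := ∑' n : ℕ, (1 / 2 : ℝ) ^ n * min 1 (dist (x n) (y n))

theorem dist_def (x y : SeqProd X) :
    dist x y = ∑' n : ℕ, (1 / 2 : ℝ) ^ n * min 1 (dist (x n) (y n)) := rfl

theorem term_nonneg (x y : SeqProd X) (n : ℕ) :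
    0 ≤ (1 / 2 : ℝ) ^ n * min 1 (dist (x n) (y n)) := by positivity

theorem summable (x y : SeqProd X) :
    Summable fun n : ℕ => (1 / 2 : ℝ) ^ n * min 1 (dist (x n) (y n)) :=
  .of_nonneg_of_le (term_nonneg x y)
    (fun _ => mul_le_of_le_one_right (by positivity) (min_le_left _ _)) summable_geometric_two

theorem term_le_dist (x y : SeqProd X) (n : ℕ) :
    (1 / 2 : ℝ) ^ n * min 1 (dist (x n) (y n)) ≤ dist x y :=
  (summable x y).le_tsum n fun j _ => term_nonneg x y j

noncomputable instance instMetricSpace : MetricSpace (SeqProd X) where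
  dist_self x := by simp [dist_def]
  dist_comm x y := by simp [dist_def, dist_comm]
  dist_triangle x y z := by
    simp only [dist_def]
    rw [← (summable x y).tsum_add (summable y z)]
    refine (summable x z).tsum_le_tsum (fun n => ?_) ((summable x y).add (summable y z))
    rw [← mul_add]
    refine mul_le_mul_of_nonneg_left ?_ (by positivity)
    have h := dist_triangle (x n) (y n) (z n)
    have h1 : 0 ≤ dist (x n) (y n) := dist_nonneg
    have h2 : 0 ≤ dist (y n) (z n) := dist_nonneg
    grind
  eq_of_dist_eq_zero {x y} h := by
    funext n
    have h1 := term_le_dist x y n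
    rw [h] at h1
    have h2 : min 1 (dist (x n) (y n)) ≤ 0 := by
      by_contra! h3
      exact absurd h1 (not_le.2 (by positivity))
    have h3 : dist (x n) (y n) ≤ 0 := by grind
    exact dist_le_zero.1 h3

end SeqProd

/-!
Uniform local connectedness and straightness depend only on the uniformity, and the metric of
`SeqProd X` induces the product uniformity, so everything takes place in a product of uniform
spaces. There a change of one coordinate is arbitrarily small for all but finitely many
coordinates. If the product is ULC, any two points of such a factor therefore lie in a connected
set, the projection of one in the product.

If `f` is continuous and uniformly continuous on each of `m` sets covering the space, then `f`
maps a small connected set onto an interval covered by `m` short pieces, so `f` oscillates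
little on small connected sets. In a ULC space this says that `f` is uniformly continuous. In a
product of precompact ULC spaces every point lies in a small connected box together with a point
of a fixed compact product of finite nets, and on that compact set `f` is uniformly continuous.

Conversely, let infinitely many factors `X (ν k)` be split by clopen sets `A k`, and let `X m`
not be precompact. Then `X m` carries a uniformly continuous `h` that takes the value `1`
somewhere on each of infinitely many disjoint open sets `U k` and vanishes off their union.
Keeping `h (x m)` when `x m ∈ U k` and `x (ν k) ∈ A k`, and replacing it by `0` when `x m ∈ U k`
and `x (ν k) ∉ A k`, gives a function that is uniformly continuous on two closed sets covering
the product, but jumps by `1` under a change of the single coordinate `ν k`, which is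
arbitrarily small for large `k`.
-/

open Filter Topology Uniformity MeasureTheory Function

section UniformNotions

variable (X : Type*) [UniformSpace X]

/-- The uniform version of `IsULC`: the small connected sets are measured by entourages. -/
def UniformlyLocallyConnected : Prop :=
  ∀ V ∈ 𝓤 X, ∀ᶠ q in 𝓤 X, ∃ C : Set X, IsConnected C ∧ q.1 ∈ C ∧ q.2 ∈ C ∧ C ×ˢ C ⊆ V

/-- The uniform version of `IsStraight`, word for word the same condition. -/
def StraightSpace : Prop :=
  ∀ F : Set (Set X), F.Finite → (∀ C ∈ F, IsClosed C) → ⋃₀ F = univ →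
    ∀ f : X → ℝ, Continuous f → (UniformContinuous f ↔ ∀ C ∈ F, UniformContinuousOn f C)

variable {X}

/-- The function `f` oscillates little on small connected sets.  This is what uniform continuity on
each member of a finite cover leaves of uniform continuity on the whole space. -/
def UniformContinuousOnConnected {Y : Type*} [PseudoMetricSpace Y] (f : X → Y) : Prop :=
  ∀ ε > 0, ∃ V ∈ 𝓤 X, ∀ C : Set X, IsConnected C → C ×ˢ C ⊆ V →
    ∀ x ∈ C, ∀ y ∈ C, dist (f x) (f y) < ε

end UniformNotions

theorem isULC_iff_uniformlyLocallyConnected {X : Type*} [MetricSpace X] :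
    IsULC X ↔ UniformlyLocallyConnected X := by
  refine ⟨fun h V hV => ?_, fun h ε hε => ?_⟩
  · obtain ⟨ε, hε, hεV⟩ := Metric.mem_uniformity_dist.1 hV
    obtain ⟨δ, hδ, hC⟩ := h ε hε
    filter_upwards [Metric.dist_mem_uniformity hδ] with q hq
    obtain ⟨C, hconn, hx, hy, hdiam⟩ := hC q.1 q.2 hq
    refine ⟨C, hconn, hx, hy, fun ⟨a, b⟩ hab => hεV ?_⟩
    have hlt := (Metric.edist_le_ediam_of_mem hab.1 hab.2).trans_lt hdiam
    rwa [edist_dist, ENNReal.ofReal_lt_ofReal_iff hε] at hlt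
  · obtain ⟨δ, hδ, hC⟩ :=
      Metric.mem_uniformity_dist.1 (h _ (Metric.dist_mem_uniformity (half_pos hε)))
    refine ⟨δ, hδ, fun x y hxy => ?_⟩
    obtain ⟨C, hconn, hx, hy, hCε⟩ := hC hxy
    have hdiam : Metric.ediam C ≤ ENNReal.ofReal (ε / 2) :=
      Metric.ediam_le_of_forall_dist_le fun a ha b hb => (hCε (mk_mem_prod ha hb)).le
    exact ⟨C, hconn, hx, hy, hdiam.trans_lt ((ENNReal.ofReal_lt_ofReal_iff hε).2 (half_lt_self hε))⟩

section Oscillation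

theorem dist_le_card_mul_of_isPreconnected {X : Type*} [TopologicalSpace X] {f : X → ℝ} {C : Set X}
    (hC : IsPreconnected C) (hf : ContinuousOn f C) {F : Finset (Set X)} (hcov : C ⊆ ⋃₀ F) {ε : ℝ}
    (hε : ∀ A ∈ F, ∀ x ∈ C ∩ A, ∀ y ∈ C ∩ A, dist (f x) (f y) ≤ ε) {x y : X} (hx : x ∈ C)
    (hy : y ∈ C) : dist (f x) (f y) ≤ F.card * ε := by
  have hε₀ : 0 ≤ ε := by
    obtain ⟨A, hA, hxA⟩ := hcov hx
    exact dist_nonneg.trans (hε A hA x ⟨hx, hxA⟩ x ⟨hx, hxA⟩)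
  have hinterval : uIcc (f x) (f y) ⊆ ⋃ A ∈ F, f '' (C ∩ A) := by
    refine ((hC.image f hf).ordConnected.uIcc_subset (mem_image_of_mem f hx)
      (mem_image_of_mem f hy)).trans ?_
    rintro _ ⟨z, hz, rfl⟩
    obtain ⟨A, hA, hzA⟩ := hcov hz
    exact mem_biUnion hA ⟨z, ⟨hz, hzA⟩, rfl⟩
  have hpiece : ∀ A ∈ F, volume (f '' (C ∩ A)) ≤ ENNReal.ofReal ε := fun A hA => by
    refine (Real.volume_le_diam _).trans (Metric.ediam_le_of_forall_dist_le ?_)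
    rintro _ ⟨a, ha, rfl⟩ _ ⟨b, hb, rfl⟩
    exact hε A hA a ha b hb
  rw [← ENNReal.ofReal_le_ofReal_iff (by positivity)]
  calc ENNReal.ofReal (dist (f x) (f y)) = volume (uIcc (f x) (f y)) := by
        rw [Real.volume_interval, dist_comm, Real.dist_eq]
    _ ≤ volume (⋃ A ∈ F, f '' (C ∩ A)) := measure_mono hinterval
    _ ≤ ∑ A ∈ F, volume (f '' (C ∩ A)) := measure_biUnion_finset_le _ _
    _ ≤ F.card • ENNReal.ofReal ε := Finset.sum_le_card_nsmul _ _ _ hpiece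
    _ = ENNReal.ofReal (F.card * ε) := by rw [← ENNReal.ofReal_nsmul, nsmul_eq_mul]

variable {X : Type*} [UniformSpace X]

theorem uniformContinuous_iff_eventually_dist_lt {Y : Type*} [PseudoMetricSpace Y] {f : X → Y} :
    UniformContinuous f ↔ ∀ ε > 0, ∀ᶠ q in 𝓤 X, dist (f q.1) (f q.2) < ε :=
  Metric.uniformity_basis_dist.tendsto_right_iff

theorem uniformContinuousOn_iff_eventually_dist_lt {Y : Type*} [PseudoMetricSpace Y] {f : X → Y}
    {s : Set X} : UniformContinuousOn f s ↔
      ∀ ε > 0, ∀ᶠ q in 𝓤 X, q ∈ s ×ˢ s → dist (f q.1) (f q.2) < ε := by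
  simp only [UniformContinuousOn, Metric.uniformity_basis_dist.tendsto_right_iff,
    eventually_inf_principal, mem_ofPred_eq]

theorem uniformContinuousOnConnected_of_finite_cover {F : Set (Set X)} (hF : F.Finite)
    (hcov : ⋃₀ F = univ) {f : X → ℝ} (hf : Continuous f)
    (hFf : ∀ A ∈ F, UniformContinuousOn f A) : UniformContinuousOnConnected f := by
  intro ε hε
  lift F to Finset (Set X) using hF
  obtain ⟨η, hη, hηε⟩ : ∃ η > 0, F.card * η < ε := exists_pos_mul_lt hε _
  refine ⟨_, (eventually_all_finset F).2 fun A hA =>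
    uniformContinuousOn_iff_eventually_dist_lt.1 (hFf A hA) η hη, fun C hC hCV x hx y hy => ?_⟩
  refine (dist_le_card_mul_of_isPreconnected hC.isPreconnected hf.continuousOn
    (hcov ▸ subset_univ C) (fun A hA a ha b hb => ?_) hx hy).trans_lt hηε
  exact (hCV (mk_mem_prod ha.1 hb.1) A hA ⟨ha.2, hb.2⟩).le

theorem straightSpace_of_forall_uniformContinuous
    (h : ∀ f : X → ℝ, Continuous f → UniformContinuousOnConnected f → UniformContinuous f) :
    StraightSpace X :=
  fun _ hF _ hcov f hf => ⟨fun huc _ _ => huc.uniformContinuousOn, fun hFf =>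
    h f hf (uniformContinuousOnConnected_of_finite_cover hF hcov hf hFf)⟩

theorem UniformlyLocallyConnected.straightSpace (hX : UniformlyLocallyConnected X) :
    StraightSpace X := by
  refine straightSpace_of_forall_uniformContinuous fun f _ hf =>
    uniformContinuous_iff_eventually_dist_lt.2 fun ε hε => ?_
  obtain ⟨V, hV, hosc⟩ := hf ε hε
  filter_upwards [hX V hV] with q ⟨C, hC, hx, hy, hCV⟩
  exact hosc C hC hCV _ hx _ hy

theorem StraightSpace.uniformContinuous_indicator (hX : StraightSpace X) {h : X → ℝ}
    (hh : UniformContinuous h) {E E' : Set X} (hE : IsOpen E) (hE' : IsOpen E')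
    (hdisj : Disjoint E E') (hsupp : support h ⊆ E ∪ E') : UniformContinuous (E.indicator h) := by
  have hzero : EqOn (E.indicator h) (fun _ => 0) Eᶜ := fun x hx => indicator_of_notMem hx h
  have heq : EqOn (E.indicator h) h E'ᶜ := fun x hx =>
    indicator_apply_eq_self.2 fun hxE => notMem_support.1 fun hxh => (hsupp hxh).elim hxE hx
  have hucE : UniformContinuousOn (E.indicator h) Eᶜ :=
    uniformContinuous_const.uniformContinuousOn.congr hzero.symm
  have hucE' : UniformContinuousOn (E.indicator h) E'ᶜ := hh.uniformContinuousOn.congr heq.symm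
  have hcov : Eᶜ ∪ E'ᶜ = univ := by rw [← compl_inter, hdisj.inter_eq, compl_empty]
  have hcont : Continuous (E.indicator h) := by
    rw [← continuousOn_univ, ← hcov]
    exact hucE.continuousOn.union_of_isClosed hucE'.continuousOn hE.isClosed_compl
      hE'.isClosed_compl
  refine (hX {Eᶜ, E'ᶜ} (toFinite _) ?_ (by rwa [sUnion_pair]) _ hcont).2 ?_
  · rintro _ (rfl | rfl)
    exacts [hE.isClosed_compl, hE'.isClosed_compl]
  · rintro _ (rfl | rfl)
    exacts [hucE, hucE']

theorem StraightSpace.uniformContinuous_indicator_iUnion (hX : StraightSpace X) {h : X → ℝ}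
    (hh : UniformContinuous h) {κ : Type*} {U A : κ → Set X} (hU : ∀ k, IsOpen (U k))
    (hdisj : Pairwise (Disjoint on U)) (hsupp : support h ⊆ ⋃ k, U k) (hA : ∀ k, IsClopen (A k)) :
    UniformContinuous ((⋃ k, U k ∩ A k).indicator h) := by
  refine hX.uniformContinuous_indicator hh (E' := ⋃ k, U k \ A k)
    (isOpen_iUnion fun k => (hU k).inter (hA k).isOpen)
    (isOpen_iUnion fun k => (hU k).sdiff (hA k).isClosed) ?_ ?_
  · refine disjoint_iUnion_left.2 fun j => disjoint_iUnion_right.2 fun k => ?_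
    obtain rfl | hjk := eq_or_ne j k
    · exact disjoint_sdiff_right.mono_left inter_subset_right
    · exact (hdisj hjk).mono inter_subset_left sdiff_subset
  · rw [← iUnion_union_distrib]
    simpa only [inter_union_sdiff] using hsupp

end Oscillation

theorem exists_isClopen_of_not_connectedSpace {X : Type*} [TopologicalSpace X] [Nonempty X]
    (hX : ¬ ConnectedSpace X) : ∃ A : Set X, IsClopen A ∧ (∃ a, a ∈ A) ∧ ∃ b, b ∉ A := by
  rw [connectedSpace_iff_clopen] at hX
  push Not at hX
  obtain ⟨A, hA, hne, huniv⟩ := hX inferInstance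
  exact ⟨A, hA, hne, (ne_univ_iff_exists_notMem A).1 huniv⟩

section Bumps

variable {X : Type*} [PseudoMetricSpace X]

theorem exists_separated_seq_of_not_totallyBounded (hX : ¬ TotallyBounded (univ : Set X)) :
    ∃ r > 0, ∃ c : ℕ → X, Pairwise fun i j => r ≤ dist (c i) (c j) := by
  rw [Metric.totallyBounded_iff] at hX
  push Not at hX
  obtain ⟨r, hr, hballs⟩ := hX
  have : Std.Symm fun x y : X => r ≤ dist x y := ⟨fun x y h => by rwa [dist_comm]⟩
  obtain ⟨c, -, hc⟩ := exists_seq_of_forall_finset_exists' (fun _ : X => True)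
    (fun x y => r ≤ dist x y) fun t _ => by
      obtain ⟨y, -, hy⟩ := not_subset.1 (hballs t t.finite_toSet)
      refine ⟨y, trivial, fun x hx => not_lt.1 fun hlt => hy (mem_biUnion hx ?_)⟩
      rwa [Metric.mem_ball, dist_comm]
  exact ⟨r, hr, c, hc⟩

theorem exists_uniformContinuous_bumps_of_not_totallyBounded
    (hX : ¬ TotallyBounded (univ : Set X)) :
    ∃ (h : X → ℝ) (U : ℕ → Set X) (c : ℕ → X), UniformContinuous h ∧ (∀ k, IsOpen (U k)) ∧
      Pairwise (Disjoint on U) ∧ support h ⊆ ⋃ k, U k ∧ ∀ k, c k ∈ U k ∧ h (c k) = 1 := by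
  obtain ⟨r, hr, c, hc⟩ := exists_separated_seq_of_not_totallyBounded hX
  have hr₂ : 0 < r / 2 := half_pos hr
  refine ⟨fun x => thickenedIndicator hr₂ (range c) x, fun k => Metric.ball (c k) (r / 2), c,
    uniformContinuous_subtype_val.comp (lipschitzWith_thickenedIndicator hr₂ _).uniformContinuous,
    fun k => Metric.isOpen_ball, fun i j hij => Metric.ball_disjoint_ball ?_, fun x hx => ?_,
    fun k => ⟨Metric.mem_ball_self hr₂, ?_⟩⟩
  · simpa only [add_halves] using hc hij
  · by_contra hxU
    rw [← biUnion_range (g := fun y => Metric.ball y (r / 2)),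
      ← Metric.thickening_eq_biUnion_ball] at hxU
    exact hx (NNReal.coe_eq_zero.2 (thickenedIndicator_zero hr₂ _ hxU))
  · exact NNReal.coe_eq_one.2 (thickenedIndicator_one hr₂ _ (mem_range_self k))

end Bumps

section Product

variable {ι : Type*} {X : ι → Type*} [∀ i, UniformSpace (X i)]

theorem exists_finite_of_mem_uniformity_pi {V : Set ((∀ i, X i) × ∀ i, X i)}
    (hV : V ∈ 𝓤 (∀ i, X i)) :
    ∃ (I : Set ι) (U : ∀ i, Set (X i × X i)), I.Finite ∧ (∀ i, U i ∈ 𝓤 (X i)) ∧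
      ∀ x y : ∀ i, X i, (∀ i ∈ I, (x i, y i) ∈ U i) → (x, y) ∈ V := by
  rw [Pi.uniformity, mem_iInf'] at hV
  obtain ⟨I, hI, T, hT, -, rfl, -⟩ := hV
  choose U hU hUT using fun i => mem_comap.1 (hT i)
  exact ⟨I, U, hI, hU, fun x y hxy => mem_iInter₂.2 fun i hi => hUT i (hxy i hi)⟩

theorem eventually_uniformity_pi {I : Set ι} (hI : I.Finite) {U : ∀ i, Set (X i × X i)}
    (hU : ∀ i, U i ∈ 𝓤 (X i)) : ∀ᶠ q in 𝓤 (∀ i, X i), ∀ i ∈ I, (q.1 i, q.2 i) ∈ U i :=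
  (eventually_all_finite hI).2 fun i _ => Pi.uniformContinuous_proj X i (hU i)

theorem eventually_cofinite_update_mem [DecidableEq ι] {V : Set ((∀ i, X i) × ∀ i, X i)}
    (hV : V ∈ 𝓤 (∀ i, X i)) :
    ∀ᶠ i in cofinite, ∀ (x : ∀ i, X i) (a b : X i), (update x i a, update x i b) ∈ V := by
  obtain ⟨I, U, hI, hU, hIV⟩ := exists_finite_of_mem_uniformity_pi hV
  filter_upwards [hI.compl_mem_cofinite] with i hi x a b
  refine hIV _ _ fun j hj => ?_
  have hji : j ≠ i := ne_of_mem_of_not_mem hj hi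
  rw [update_of_ne hji, update_of_ne hji]
  exact refl_mem_uniformity (hU j)

/-- The small connected sets are boxes, whose sides may be whole factors where `V` imposes no
condition. -/
theorem exists_isConnected_pi (hX : ∀ i, UniformlyLocallyConnected (X i))
    {V : Set ((∀ i, X i) × ∀ i, X i)} (hV : V ∈ 𝓤 (∀ i, X i)) :
    ∃ (I : Set ι) (W : ∀ i, Set (X i × X i)), I.Finite ∧ (∀ i, W i ∈ 𝓤 (X i)) ∧
      ∀ x y : ∀ i, X i, (∀ i, (x i, y i) ∈ W i ∨ i ∉ I ∧ ConnectedSpace (X i)) →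
        ∃ C : Set (∀ i, X i), IsConnected C ∧ x ∈ C ∧ y ∈ C ∧ C ×ˢ C ⊆ V := by
  obtain ⟨I, U, hI, hU, hIV⟩ := exists_finite_of_mem_uniformity_pi hV
  refine ⟨I, _, hI, fun i => hX i (U i) (hU i), fun x y hxy => ?_⟩
  have hside : ∀ i, ∃ C : Set (X i), IsConnected C ∧ x i ∈ C ∧ y i ∈ C ∧
      (i ∈ I → C ×ˢ C ⊆ U i) := fun i => by
    rcases hxy i with ⟨C, hC, hx, hy, hCU⟩ | ⟨hi, _⟩
    · exact ⟨C, hC, hx, hy, fun _ => hCU⟩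
    · exact ⟨univ, isConnected_univ, mem_univ _, mem_univ _, fun h => absurd h hi⟩
  choose C hC hx hy hCU using hside
  exact ⟨univ.pi C, isConnected_univ_pi.2 hC, fun i _ => hx i, fun i _ => hy i,
    fun ⟨a, b⟩ hab => hIV a b fun i hi => hCU i hi ⟨hab.1 i trivial, hab.2 i trivial⟩⟩

theorem UniformlyLocallyConnected.pi (hX : ∀ i, UniformlyLocallyConnected (X i))
    (hfin : {i | ¬ ConnectedSpace (X i)}.Finite) : UniformlyLocallyConnected (∀ i, X i) := by
  intro V hV
  obtain ⟨I, W, hI, hW, hC⟩ := exists_isConnected_pi hX hV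
  filter_upwards [eventually_uniformity_pi (hI.union hfin) hW] with q hq
  refine hC q.1 q.2 fun i => ?_
  by_cases hi : i ∈ I ∪ {i | ¬ ConnectedSpace (X i)}
  · exact .inl (hq i hi)
  · exact .inr ⟨fun hiI => hi (.inl hiI), not_not.1 fun hconn => hi (.inr hconn)⟩

theorem UniformlyLocallyConnected.finite_not_connectedSpace [∀ i, Nonempty (X i)]
    (h : UniformlyLocallyConnected (∀ i, X i)) : {i | ¬ ConnectedSpace (X i)}.Finite := by
  classical
  refine (eventually_cofinite_update_mem (h univ univ_mem)).mono fun i hi => ?_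
  have : PreconnectedSpace (X i) := by
    refine ⟨isPreconnected_of_forall_pair fun a _ b _ => ?_⟩
    obtain ⟨C, hC, ha, hb, -⟩ := hi (fun _ => Classical.arbitrary _) a b
    exact ⟨eval i '' C, subset_univ _, by simpa using mem_image_of_mem (eval i) ha,
      by simpa using mem_image_of_mem (eval i) hb,
      hC.isPreconnected.image _ (continuous_apply i).continuousOn⟩
  exact ⟨inferInstance⟩

theorem exists_finite_net_of_totallyBounded {Y : Type*} [UniformSpace Y]
    (hY : TotallyBounded (univ : Set Y)) {W : Set (Y × Y)} (hW : W ∈ 𝓤 Y) :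
    ∃ (P : Set Y) (r : Y → Y), P.Finite ∧ (∀ a, r a ∈ P) ∧ ∀ a, (a, r a) ∈ W := by
  obtain ⟨P, hP, hcov⟩ := hY W hW
  have hnear : ∀ a, ∃ p ∈ P, (a, p) ∈ W := fun a => by simpa using hcov (mem_univ a)
  choose r hrP hrW using hnear
  exact ⟨P, r, hP, hrP, hrW⟩

theorem exists_isCompact_approx_pi (hX : ∀ i, TotallyBounded (univ : Set (X i)))
    {W : ∀ i, Set (X i × X i)} (hW : ∀ i, W i ∈ 𝓤 (X i)) :
    ∃ K : Set (∀ i, X i), IsCompact K ∧ ∀ V ∈ 𝓤 (∀ i, X i), ∀ᶠ q in 𝓤 (∀ i, X i),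
      ∃ x ∈ K, ∃ y ∈ K, (x, y) ∈ V ∧ (∀ i, (q.1 i, x i) ∈ W i) ∧ ∀ i, (q.2 i, y i) ∈ W i := by
  classical
  choose W' hW' hsymm hcomp using fun i => comp_symm_mem_uniformity_sets (hW i)
  choose P r hP hrP hrW' using fun i => exists_finite_net_of_totallyBounded (hX i) (hW' i)
  have hrW : ∀ i a, (a, r i a) ∈ W i := fun i a =>
    hcomp i ⟨a, refl_mem_uniformity (hW' i), hrW' i a⟩
  refine ⟨univ.pi P, isCompact_univ_pi fun i => (hP i).isCompact, fun V hV => ?_⟩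
  obtain ⟨I, U, hI, hU, hIV⟩ := exists_finite_of_mem_uniformity_pi hV
  filter_upwards [eventually_uniformity_pi hI hW'] with ⟨x, y⟩ hxy
  -- On the coordinates controlled by `V`, approximate `y` by the net points chosen for `x`.
  refine ⟨fun i => r i (x i), fun i _ => hrP i _, fun i => if i ∈ I then r i (x i) else r i (y i),
    fun i _ => ?_, hIV _ _ fun i hi => ?_, fun i => hrW i _, fun i => ?_⟩
  · dsimp only
    split_ifs <;> exact hrP i _
  · rw [if_pos hi]
    exact refl_mem_uniformity (hU i)
  · dsimp only
    split_ifs with hi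
    · exact hcomp i ⟨x i, (hsymm i).symm _ _ (hxy i hi), hrW' i _⟩
    · exact hrW i _

theorem straightSpace_pi_of_totallyBounded (hX : ∀ i, UniformlyLocallyConnected (X i))
    (htb : ∀ i, TotallyBounded (univ : Set (X i))) : StraightSpace (∀ i, X i) := by
  refine straightSpace_of_forall_uniformContinuous fun f hf hfconn =>
    uniformContinuous_iff_eventually_dist_lt.2 fun ε hε => ?_
  have hε₃ : 0 < ε / 3 := by positivity
  obtain ⟨V, hV, hosc⟩ := hfconn (ε / 3) hε₃
  obtain ⟨I, W, -, hW, hC⟩ := exists_isConnected_pi hX hV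
  have hnear : ∀ x y : ∀ i, X i, (∀ i, (x i, y i) ∈ W i) → dist (f x) (f y) < ε / 3 := by
    intro x y hxy
    obtain ⟨C, hconn, hx, hy, hCV⟩ := hC x y fun i => .inl (hxy i)
    exact hosc C hconn hCV x hx y hy
  obtain ⟨K, hK, happrox⟩ := exists_isCompact_approx_pi htb hW
  have hKf : UniformContinuousOn f K := hK.uniformContinuousOn_of_continuous hf.continuousOn
  filter_upwards [happrox _ (uniformContinuousOn_iff_eventually_dist_lt.1 hKf _ hε₃)]
    with ⟨x, y⟩ ⟨x', hx', y', hy', hxy', hxx', hyy'⟩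
  calc dist (f x) (f y) ≤ dist (f x) (f x') + dist (f x') (f y') + dist (f y') (f y) :=
        dist_triangle4 ..
    _ < ε / 3 + ε / 3 + ε / 3 := by
        rw [dist_comm (f y')]
        gcongr
        exacts [hnear x x' hxx', hxy' ⟨hx', hy'⟩, hnear y y' hyy']
    _ = ε := add_thirds ε

end Product

section PseudoMetricProduct

variable {ι : Type*} {X : ι → Type*} [∀ i, PseudoMetricSpace (X i)] [∀ i, Nonempty (X i)]

theorem StraightSpace.finite_not_connectedSpace (hS : StraightSpace (∀ i, X i)) {m : ι}
    (hm : ¬ TotallyBounded (univ : Set (X m))) : {i | ¬ ConnectedSpace (X i)}.Finite := by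
  classical
  by_contra hinf
  let ν := (Set.Infinite.sdiff hinf (finite_singleton m)).natEmbedding
  have hmν : ∀ k, m ≠ ν k := fun k h => (ν k).2.2 h.symm
  obtain ⟨h, U, c, hh, hU, hdisj, hsupp, hc⟩ :=
    exists_uniformContinuous_bumps_of_not_totallyBounded hm
  choose A hA hmem hnotMem using fun k => exists_isClopen_of_not_connectedSpace (ν k).2.1
  choose a ha using hmem
  choose b hb using hnotMem
  let E : Set (∀ i, X i) := ⋃ k, eval m ⁻¹' U k ∩ eval (ν k : ι) ⁻¹' A k
  have huc : UniformContinuous (E.indicator (h ∘ eval m)) :=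
    hS.uniformContinuous_indicator_iUnion (hh.comp (Pi.uniformContinuous_proj X m))
      (fun k => (hU k).preimage (continuous_apply m)) (fun j k hjk => (hdisj hjk).preimage _)
      (fun x hx => by simpa using hsupp hx)
      fun k => (hA k).preimage (continuous_apply (ν k : ι))
  have hν : Injective fun k => (ν k : ι) := Subtype.val_injective.comp ν.injective
  obtain ⟨k, hk⟩ := (hν.tendsto_cofinite.eventually (eventually_cofinite_update_mem
    (uniformContinuous_iff_eventually_dist_lt.1 huc 1 one_pos))).exists
  let x : ∀ i, X i := update (fun _ => Classical.arbitrary _) m (c k)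
  have hxm : ∀ y, update x (ν k) y m = c k := fun y =>
    (update_of_ne (hmν k) y x).trans (update_self m (c k) _)
  have hxa : update x (ν k) (a k) ∈ E :=
    mem_iUnion.2 ⟨k, by simpa [hxm] using ⟨(hc k).1, ha k⟩⟩
  have hxb : update x (ν k) (b k) ∉ E := fun hbE => by
    obtain ⟨j, hjU, hjA⟩ := mem_iUnion.1 hbE
    obtain rfl : j = k := hdisj.eq (not_disjoint_iff.2 ⟨c k, hxm (b k) ▸ hjU, (hc k).1⟩)
    exact hb j (by simpa using hjA)
  have hjump : dist (h (c k)) 0 < 1 := by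
    simpa only [indicator_of_mem hxa, indicator_of_notMem hxb, mem_ofPred_eq, comp_apply, eval, hxm]
      using hk x (a k) (b k)
  simp [hc k] at hjump

end PseudoMetricProduct

namespace SeqProd

variable {X : ℕ → Type u} [∀ n, MetricSpace (X n)]

theorem uniformContinuous_eval (n : ℕ) : UniformContinuous fun x : SeqProd X => x n := by
  refine Metric.uniformContinuous_iff.2 fun ε hε =>
    ⟨(1 / 2 : ℝ) ^ n * min 1 ε, by positivity, fun {x y} hxy => ?_⟩
  have hmin : min 1 (dist (x n) (y n)) < min 1 ε :=
    lt_of_mul_lt_mul_left ((term_le_dist x y n).trans_lt hxy) (by positivity)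
  grind

theorem tendsto_dist_uniformity_pi :
    Tendsto (fun q : (∀ n, X n) × ∀ n, X n => dist (α := SeqProd X) q.1 q.2) (𝓤 (∀ n, X n))
      (𝓝 0) := by
  rw [← tsum_zero (α := ℝ) (β := ℕ)]
  refine tendsto_tsum_of_dominated_convergence summable_geometric_two (fun n => ?_)
    (.of_forall fun q n => ?_)
  · have hdist : Tendsto (fun q : (∀ n, X n) × ∀ n, X n => dist (q.1 n) (q.2 n)) (𝓤 (∀ n, X n))
        (𝓝 0) := tendsto_uniformity_iff_dist_tendsto_zero.1 (Pi.uniformContinuous_proj X n)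
    simpa using ((tendsto_const_nhds (x := (1 : ℝ))).min hdist).const_mul ((1 / 2 : ℝ) ^ n)
  · rw [Real.norm_of_nonneg (term_nonneg (X := X) q.1 q.2 n)]
    exact mul_le_of_le_one_right (by positivity) (min_le_left _ _)

theorem uniformSpace_eq :
    (inferInstanceAs (UniformSpace (SeqProd X)) : UniformSpace (∀ n, X n)) =
      Pi.uniformSpace X :=
  UniformSpace.ext (le_antisymm (uniformContinuous_pi (β := SeqProd X).2 uniformContinuous_eval)
    (tendsto_uniformity_iff_dist_tendsto_zero.2 (tendsto_dist_uniformity_pi (X := X))))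

theorem isULC_iff : IsULC (SeqProd X) ↔ UniformlyLocallyConnected (∀ n, X n) := by
  rw [isULC_iff_uniformlyLocallyConnected, ← uniformSpace_eq]
  rfl

theorem isStraight_iff : IsStraight (SeqProd X) ↔ StraightSpace (∀ n, X n) := by
  rw [← uniformSpace_eq]
  rfl

end SeqProd

theorem theoremB_general {ι : Type*} (X : ι → Type*) [∀ i, PseudoMetricSpace (X i)]
    [∀ i, Nonempty (X i)] (hX : ∀ i, UniformlyLocallyConnected (X i)) :
    (UniformlyLocallyConnected (∀ i, X i) ↔ {i | ¬ ConnectedSpace (X i)}.Finite) ∧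
    (StraightSpace (∀ i, X i) ↔
      UniformlyLocallyConnected (∀ i, X i) ∨ ∀ i, TotallyBounded (univ : Set (X i))) := by
  refine ⟨⟨fun h => h.finite_not_connectedSpace, .pi hX⟩, fun hS => ?_, ?_⟩
  · by_contra! ⟨hU, m, hm⟩
    exact hU (.pi hX (hS.finite_not_connectedSpace hm))
  · rintro (h | h)
    exacts [h.straightSpace, straightSpace_pi_of_totallyBounded hX h]

theorem theoremB (X : ℕ → Type u) [∀ n, MetricSpace (X n)] [∀ n, Nonempty (X n)]
    (hX : ∀ n, IsULC (X n)) :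
    (IsULC (SeqProd X) ↔ {n : ℕ | ¬ ConnectedSpace (X n)}.Finite) ∧
    (IsStraight (SeqProd X) ↔ IsULC (SeqProd X) ∨ ∀ n, IsPrecompact (X n)) := by
  rw [SeqProd.isULC_iff, SeqProd.isStraight_iff]
  exact theoremB_general X fun n => isULC_iff_uniformlyLocallyConnected.1 (hX n)
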